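/- Let $ABC$ be a nondegenerate triangle in the Euclidean plane. For a triangle $ABC$, the external Morley triangle opposite $A$ is the triangle $A_AB_AC_A$ obtained from the trisectors of the interior angle at $A$ and of two exterior angles: the one at $B$ between $BC$ and the extension of $AB$ beyond $B$, and the one at $C$ between $CB$ and the extension of $AC$ beyond $C$. Namely, * $A_A$ is the intersection of the trisector of this exterior angle at $B$ nearer to $BC$ and the trisector of this exterior angle at $C$ nearer to $CB$; * $B_A$ is the intersection of the trisector of the interior angle at $A$ nearer to $AB$ and the trisector of this exterior angle at $B$ nearer to the extension of $AB$; * $C_A$ is the intersection of the trisector of the interior angle at $A$ nearer to $AC$ and the trisector of this exterior angle at $C$ nearer to the extension of $AC$. Define the external Morley triangles $B_BC_BA_B$ (opposite $B$) and $C_CA_CB_C$ (opposite $C$) in the same way, by cyclic permutation of $A,B,C$: thus $B_B$, $C_B$, $A_B$ are the vertices adjacent to the lines $CA$, $BC$, $AB$ respectively, and $C_C$, $A_C$, $B_C$ are the vertices adjacent to $AB$, $CA$, $BC$ respectively. These give the three external Morley triangles $A_AB_AC_A$, $A_BB_BC_B$, $A_CB_CC_C$ of $ABC$. Then each of the triples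 $\{A_A,A_B,A_C\}$, $\{B_B,B_C,B_A\}$, $\{C_C,C_A,C_B\}$ and each of the quadruples $\{C_A,B_A,B_B,C_C\}$, $\{A_B,C_B,C_C,A_A\}$, $\{B_C,A_C,A_A,B_B\}$ lies on a unique circle. Let $l_A$ be the radical line (the set of points of equal power) of the circles $(A_AA_BA_C)$ and $(C_AB_AB_BC_C)$, let $l_B$ be the radical line of $(B_BB_CB_A)$ and $(A_BC_BC_CA_A)$, and let $l_C$ be the radical line of $(C_CC_AC_B)$ and $(B_CA_CA_AB_B)$. Then $l_A$, $l_B$, $l_C$ are lines which form a nondegenerate triangle $XYZ$, with $X=l_B\cap l_C$, $Y=l_C\cap l_A$, $Z=l_A\cap l_B$, and this triangle is perspective to $ABC$: $X\neq A$, $Y\neq B$, $Z\neq C$, and the lines $AX$, $BY$, $CZ$ pass through a common point. -/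

import Mathlib

open EuclideanGeometry

/-- The Euclidean plane. -/
abbrev Plane := EuclideanSpace ℝ (Fin 2)

/-- `X` lies on the (open) ray from `V` that trisects the angle `PVQ` and is the one of the two
trisectors nearer to the side `VP`: the angle `PVX` is a third, and the angle `XVQ` two thirds,
of the angle `PVQ`. (For `0 < ∠ P V Q < π` this singles out exactly one ray in the plane.) -/
def OnTrisector (P V Q X : Plane) : Prop :=
  X ≠ V ∧ ∠ P V X = ∠ P V Q / 3 ∧ ∠ X V Q = 2 * ∠ P V Q / 3

/-- `X Y Z` is the external Morley triangle of the triangle `A B C` lying opposite `A`: its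
vertices are the intersections of adjacent trisectors of the interior angle at `A`
and of the exterior angles at `B` (between `BC` and the extension of `AB` beyond `B`) and
at `C` (between `CB` and the extension of `AC` beyond `C`).
`X` belongs to the side `BC`, `Y` to the side `AB`, and `Z` to the side `AC`. -/
structure IsExternalMorleyTriangle (A B C X Y Z : Plane) : Prop where
  /-- `X` is on the trisector of the exterior angle at `B` nearer to `BC`. -/
  fst_B : OnTrisector C B (AffineEquiv.pointReflection ℝ B A) X
  /-- `X` is on the trisector of the exterior angle at `C` nearer to `CB`. -/
  fst_C : OnTrisector B C (AffineEquiv.pointReflection ℝ C A) X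
  /-- `Y` is on the trisector of the interior angle at `A` nearer to `AB`. -/
  snd_A : OnTrisector B A C Y
  /-- `Y` is on the trisector of the exterior angle at `B` nearer to the line `AB`. -/
  snd_B : OnTrisector (AffineEquiv.pointReflection ℝ B A) B C Y
  /-- `Z` is on the trisector of the interior angle at `A` nearer to `AC`. -/
  trd_A : OnTrisector C A B Z
  /-- `Z` is on the trisector of the exterior angle at `C` nearer to the line `AC`. -/
  trd_C : OnTrisector (AffineEquiv.pointReflection ℝ C A) C B Z

/-- `ω` is the circle through the points of `s`: it contains `s` and is the only circle to do so. -/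
def IsCircleThrough (ω : Sphere Plane) (s : Set Plane) : Prop :=
  s ⊆ (ω : Set Plane) ∧ ∀ ω' : Sphere Plane, s ⊆ (ω' : Set Plane) → ω' = ω

/-- The radical line of two circles: the points of equal power with respect to both. -/
def radicalLine (ω₁ ω₂ : Sphere Plane) : Set Plane :=
  {P | ω₁.power P = ω₂.power P}

/-- The circle through the points of `s` and the circle through the points of `t` both exist,
and `l` is a straight line, namely their radical line. -/
def IsRadicalLineOf (l : AffineSubspace ℝ Plane) (s t : Set Plane) : Prop :=
  Module.finrank ℝ l.direction = 1 ∧ ∃ ω₁ ω₂ : Sphere Plane,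
    IsCircleThrough ω₁ s ∧ IsCircleThrough ω₂ t ∧ (l : Set Plane) = radicalLine ω₁ ω₂

/-- The three lines `l₁, l₂, l₃` form the (nondegenerate) triangle `X Y Z`, where `l₁, l₂, l₃`
are the side lines opposite `X, Y, Z`. -/
def FormTriangle (l₁ l₂ l₃ : AffineSubspace ℝ Plane) (X Y Z : Plane) : Prop :=
  AffineIndependent ℝ ![X, Y, Z] ∧ l₁ = line[ℝ, Y, Z] ∧ l₂ = line[ℝ, Z, X] ∧ l₃ = line[ℝ, X, Y]

/-- The triangles `A B C` and `X Y Z` are perspective: the lines `AX, BY, CZ` are concurrent. -/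
def ArePerspective (A B C X Y Z : Plane) : Prop :=
  A ≠ X ∧ B ≠ Y ∧ C ≠ Z ∧ ∃ P : Plane, P ∈ line[ℝ, A, X] ∧ P ∈ line[ℝ, B, Y] ∧ P ∈ line[ℝ, C, Z]

/-!
Everything is computed in trilinear coordinates relative to `A B C`. Writing the angles of the
triangle as `3 α, 3 β, 3 γ` and `exp (i t) = hexV t + hexU t * exp (i π / 3)`, the side lengths, the
trilinears of the Morley vertices and the equations of the circles all become integral polynomials
in `hexU` and `hexV` of `α, β, γ`, so that concyclicity is a polynomial identity.

Put `ξ = cos (π / 3 + α)`, `η = cos (π / 3 + β)`, `ζ = cos (π / 3 + γ)`. Up to scale, the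
coefficients of the radical line `l_A` turn out to be the cofactors of the first row of the
symmetric matrix with rows `(1, ζ, η)`, `(ζ, 1, ξ)`, `(η, ξ, 1)`, and likewise for `l_B` and `l_C`;
the trilinears of `X, Y, Z` are therefore its rows. The lines `A X, B Y, C Z` consequently meet at
the point with trilinears `η ζ : ξ ζ : ξ η`. The matrix is nonsingular because
`|ξ|, |η|, |ζ| < 1 / 2` makes it strictly diagonally dominant.
-/

open scoped RealInnerProductSpace

section Barycentric

variable {V : Type*} [AddCommGroup V] [Module ℝ V] {A B C : V}

theorem affineIndependent_iff_barycentric_eq_zero : AffineIndependent ℝ ![A, B, C] ↔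
    ∀ x y z : ℝ, x + y + z = 0 → x • A + y • B + z • C = 0 → x = 0 ∧ y = 0 ∧ z = 0 := by
  rw [affineIndependent_iff_of_fintype]
  constructor
  · intro h x y z hs h0
    have hw := h ![x, y, z] (by simpa [Fin.sum_univ_three] using hs) (by
      rw [Finset.univ.weightedVSub_eq_linear_combination
        (by simpa [Fin.sum_univ_three] using hs)]
      simpa [Fin.sum_univ_three] using h0)
    exact ⟨hw 0, hw 1, hw 2⟩
  · intro h w hs h0
    rw [Finset.univ.weightedVSub_eq_linear_combination hs] at h0
    rw [Fin.sum_univ_three] at hs h0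
    obtain ⟨h₀, h₁, h₂⟩ := h _ _ _ hs h0
    intro i
    fin_cases i
    exacts [h₀, h₁, h₂]

theorem exists_affineBasis_eq [FiniteDimensional ℝ V] (hV : Module.finrank ℝ V = 2)
    (h : AffineIndependent ℝ ![A, B, C]) : ∃ b : AffineBasis (Fin 3) ℝ V, ⇑b = ![A, B, C] :=
  ⟨⟨_, h, h.affineSpan_eq_top_iff_card_eq_finrank_add_one.mpr (by simp [hV])⟩, rfl⟩

theorem exists_barycentric [FiniteDimensional ℝ V] (hV : Module.finrank ℝ V = 2)
    (h : AffineIndependent ℝ ![A, B, C]) (P : V) :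
    ∃ x y z : ℝ, x + y + z = 1 ∧ x • A + y • B + z • C = P := by
  obtain ⟨b, hb⟩ := exists_affineBasis_eq hV h
  have hs := b.sum_coord_apply_eq_one P
  have hP := b.linear_combination_coord_eq_self P
  rw [Fin.sum_univ_three] at hs hP
  rw [hb] at hP
  exact ⟨b.coord 0 P, b.coord 1 P, b.coord 2 P, hs, hP⟩

theorem exists_affineMap_apply_eq [FiniteDimensional ℝ V] (hV : Module.finrank ℝ V = 2)
    (h : AffineIndependent ℝ ![A, B, C]) (p q r : ℝ) :
    ∃ f : V →ᵃ[ℝ] ℝ, f A = p ∧ f B = q ∧ f C = r := by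
  obtain ⟨b, hb⟩ := exists_affineBasis_eq hV h
  refine ⟨p • b.coord 0 + q • b.coord 1 + r • b.coord 2, ?_, ?_, ?_⟩
  · rw [show A = b 0 by simp [hb]]
    simp
  · rw [show B = b 1 by simp [hb]]
    simp
  · rw [show C = b 2 by simp [hb]]
    simp

theorem mem_line_iff_barycentric (h : AffineIndependent ℝ ![A, B, C]) {x y z : ℝ}
    (hs : x + y + z = 1) : x • A + y • B + z • C ∈ line[ℝ, B, C] ↔ x = 0 := by
  rw [mem_affineSpan_pair_iff_exists_lineMap_eq]
  simp only [AffineMap.lineMap_apply_module]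
  constructor
  · rintro ⟨r, hr⟩
    exact (affineIndependent_iff_barycentric_eq_zero.mp h x (y - (1 - r)) (z - r)
      (by linarith) (by rw [← sub_eq_zero.mpr hr.symm]; module)).1
  · rintro rfl
    obtain rfl : y = 1 - z := by linarith
    exact ⟨z, by module⟩

theorem finrank_direction_line {B C : V} (h : B ≠ C) :
    Module.finrank ℝ line[ℝ, B, C].direction = 1 := by
  rw [direction_affineSpan, vectorSpan_pair_rev]
  exact finrank_span_singleton (sub_ne_zero.mpr h.symm)

end Barycentric

section Power

variable {E : Type*} [NormedAddCommGroup E] [InnerProductSpace ℝ E] {A B C : E}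

theorem power_barycentric (ω : Sphere E) {x y z : ℝ} (h : x + y + z = 1) :
    ω.power (x • A + y • B + z • C) = x * ω.power A + y * ω.power B + z * ω.power C -
      (y * z * dist B C ^ 2 + z * x * dist C A ^ 2 + x * y * dist A B ^ 2) := by
  obtain rfl : x = 1 - y - z := by linarith
  simp only [Sphere.power, dist_eq_norm, ← real_inner_self_eq_norm_sq, inner_sub_left,
    inner_sub_right, inner_add_left, inner_add_right, real_inner_smul_left, real_inner_smul_right,
    real_inner_comm A B, real_inner_comm A C, real_inner_comm B C, real_inner_comm A ω.center,
    real_inner_comm B ω.center, real_inner_comm C ω.center]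
  ring

theorem exists_sphere_power_eq_norm_sq_add [FiniteDimensional ℝ E] (f : E →ᵃ[ℝ] ℝ) {P : E}
    (hP : ‖P‖ ^ 2 + f P = 0) :
    ∃ ω : Sphere E, 0 ≤ ω.radius ∧ ∀ Q, ω.power Q = ‖Q‖ ^ 2 + f Q := by
  set v : E := (InnerProductSpace.toDual ℝ E).symm f.linear.toContinuousLinearMap with hv
  have hf (Q : E) : f Q = ⟪v, Q⟫ + f 0 := by
    rw [hv, InnerProductSpace.toDual_symm_apply]
    exact congrFun f.decomp Q
  refine ⟨⟨-(1 / 2 : ℝ) • v, dist P (-(1 / 2 : ℝ) • v)⟩, dist_nonneg, fun Q => ?_⟩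
  rw [hf] at hP ⊢
  simp only [Sphere.power, dist_eq_norm, ← real_inner_self_eq_norm_sq, inner_sub_left,
    inner_sub_right, real_inner_smul_left, real_inner_smul_right, real_inner_comm v] at hP ⊢
  linarith

theorem exists_sphere_power_eq [FiniteDimensional ℝ E] (hE : Module.finrank ℝ E = 2)
    (h : AffineIndependent ℝ ![A, B, C]) (p q r : ℝ) {x y z : ℝ} (hs : x + y + z = 1)
    (h0 : x * p + y * q + z * r =
      y * z * dist B C ^ 2 + z * x * dist C A ^ 2 + x * y * dist A B ^ 2) :
    ∃ ω : Sphere E, 0 ≤ ω.radius ∧ ω.power A = p ∧ ω.power B = q ∧ ω.power C = r := by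
  obtain ⟨f, hA, hB, hC⟩ := exists_affineMap_apply_eq hE h (p - ‖A‖ ^ 2) (q - ‖B‖ ^ 2) (r - ‖C‖ ^ 2)
  have hf : f (x • A + y • B + z • C) = x * f A + y * f B + z * f C := by
    have hlin (Q : E) : f Q = f.linear Q + f 0 := congrFun f.decomp Q
    rw [hlin, hlin A, hlin B, hlin C]
    simp only [map_add, map_smul, smul_eq_mul]
    linear_combination -f 0 * hs
  obtain ⟨ω, hr, hω⟩ := exists_sphere_power_eq_norm_sq_add f (P := x • A + y • B + z • C) (by
    have := power_barycentric (A := A) (B := B) (C := C) ⟨0, 0⟩ hs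
    simp only [Sphere.power, dist_zero_right] at this
    rw [hf, hA, hB, hC]
    linarith)
  exact ⟨ω, hr, by rw [hω, hA]; ring, by rw [hω, hB]; ring, by rw [hω, hC]; ring⟩

end Power

section Side

variable {E : Type*} [NormedAddCommGroup E] [NormedSpace ℝ E] {A B C : E}

theorem side_pos (hi : AffineIndependent ℝ ![A, B, C]) :
    0 < dist B C ∧ 0 < dist C A ∧ 0 < dist A B :=
  ⟨dist_pos.mpr (hi.injective.ne (show (1 : Fin 3) ≠ 2 by decide)),
    dist_pos.mpr (hi.injective.ne (show (2 : Fin 3) ≠ 0 by decide)),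
    dist_pos.mpr (hi.injective.ne (show (0 : Fin 3) ≠ 1 by decide))⟩

theorem eq_zero_of_side_weights (hi : AffineIndependent ℝ ![A, B, C]) {x y z : ℝ}
    (hs : dist B C * x + dist C A * y + dist A B * z = 0)
    (h0 : (dist B C * x) • A + (dist C A * y) • B + (dist A B * z) • C = 0) :
    x = 0 ∧ y = 0 ∧ z = 0 := by
  obtain ⟨ha, hb, hc⟩ := side_pos hi
  simpa [ha.ne', hb.ne', hc.ne'] using
    affineIndependent_iff_barycentric_eq_zero.mp hi _ _ _ hs h0

end Side

/-- `x : y : z` are homogeneous trilinear coordinates of `P` relative to the triangle `A B C`, that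
is, `BC x : CA y : AB z` are homogeneous barycentric coordinates of `P`. The triple is normalised
neither in scale nor in sign; the first condition keeps it off the line at infinity. -/
structure HasTrilinears {E : Type*} [NormedAddCommGroup E] [NormedSpace ℝ E] (A B C P : E)
    (x y z : ℝ) : Prop where
  sum_ne_zero : dist B C * x + dist C A * y + dist A B * z ≠ 0
  smul_eq : (dist B C * x + dist C A * y + dist A B * z) • P =
    (dist B C * x) • A + (dist C A * y) • B + (dist A B * z) • C

namespace HasTrilinears

variable {E : Type*} [NormedAddCommGroup E] [NormedSpace ℝ E] {A B C P Q R : E}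
  {x y z x' y' z' x'' y'' z'' t : ℝ}

theorem rotate (h : HasTrilinears A B C P x y z) : HasTrilinears B C A P y z x where
  sum_ne_zero hs := h.sum_ne_zero (by linarith)
  smul_eq := by
    convert h.smul_eq using 1
    · congr 1
      ring
    · abel

theorem swap (h : HasTrilinears A B C P x y z) : HasTrilinears A C B P x z y where
  sum_ne_zero hs := h.sum_ne_zero (by rw [← hs, dist_comm C B, dist_comm B A, dist_comm A C]; ring)
  smul_eq := by
    rw [dist_comm C B, dist_comm B A, dist_comm A C]
    convert h.smul_eq using 1
    · congr 1
      ring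
    · abel

theorem of_mul (h : HasTrilinears A B C P (t * x) (t * y) (t * z)) :
    HasTrilinears A B C P x y z := by
  have ht : t ≠ 0 := by
    rintro rfl
    simpa using h.sum_ne_zero
  refine ⟨fun hs => h.sum_ne_zero (by linear_combination t * hs), smul_right_injective E ht ?_⟩
  have h' := h.smul_eq
  dsimp only
  convert h' using 1 <;> module

theorem exists_of_sum_ne_zero (hs : dist B C * x + dist C A * y + dist A B * z ≠ 0) :
    ∃ P, HasTrilinears A B C P x y z :=
  ⟨_, hs, smul_inv_smul₀ hs _⟩

theorem vertex (h : B ≠ C) : HasTrilinears A B C A 1 0 0 :=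
  ⟨by simpa using h, by simp⟩

theorem eq_barycentric (h : HasTrilinears A B C P x y z) :
    P = (dist B C * x / (dist B C * x + dist C A * y + dist A B * z)) • A +
      (dist C A * y / (dist B C * x + dist C A * y + dist A B * z)) • B +
      (dist A B * z / (dist B C * x + dist C A * y + dist A B * z)) • C := by
  rw [← inv_smul_smul₀ h.sum_ne_zero P, h.smul_eq]
  module

theorem barycentric_sum (h : HasTrilinears A B C P x y z) :
    dist B C * x / (dist B C * x + dist C A * y + dist A B * z) +
      dist C A * y / (dist B C * x + dist C A * y + dist A B * z) +
      dist A B * z / (dist B C * x + dist C A * y + dist A B * z) = 1 := by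
  rw [← add_div, ← add_div, div_self h.sum_ne_zero]

theorem exists_of_affineIndependent [FiniteDimensional ℝ E] (hE : Module.finrank ℝ E = 2)
    (hi : AffineIndependent ℝ ![A, B, C]) (P : E) : ∃ x y z, HasTrilinears A B C P x y z := by
  obtain ⟨x, y, z, hs, rfl⟩ := exists_barycentric hE hi P
  obtain ⟨ha, hb, hc⟩ := side_pos hi
  refine ⟨x / dist B C, y / dist C A, z / dist A B, ?_, ?_⟩ <;>
    simp only [mul_div_cancel₀ _ ha.ne', mul_div_cancel₀ _ hb.ne', mul_div_cancel₀ _ hc.ne', hs]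
  · exact one_ne_zero
  · exact one_smul ℝ _

theorem mul_eq_mul (hi : AffineIndependent ℝ ![A, B, C]) (h : HasTrilinears A B C P x y z)
    (h' : HasTrilinears A B C P x' y' z') : x * y' = y * x' := by
  have hS := h.sum_ne_zero
  have hS' := h'.sum_ne_zero
  have hP := h.eq_barycentric
  have hP' := h'.eq_barycentric
  set S := dist B C * x + dist C A * y + dist A B * z
  set S' := dist B C * x' + dist C A * y' + dist A B * z'
  obtain ⟨hx, hy, -⟩ := eq_zero_of_side_weights hi (x := x / S - x' / S') (y := y / S - y' / S')
    (z := z / S - z' / S')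
    (by linear_combination h.barycentric_sum - h'.barycentric_sum)
    (by rw [← sub_eq_zero.mpr (hP.symm.trans hP')]; module)
  field_simp at hx hy
  exact mul_left_cancel₀ hS' (by linear_combination y' * hx - x' * hy)

theorem affineIndependent (hi : AffineIndependent ℝ ![A, B, C])
    (hP : HasTrilinears A B C P x y z) (hQ : HasTrilinears A B C Q x' y' z')
    (hR : HasTrilinears A B C R x'' y'' z'')
    (hdet : !![x, y, z; x', y', z'; x'', y'', z''].det ≠ 0) :
    AffineIndependent ℝ ![P, Q, R] := by
  rw [affineIndependent_iff_barycentric_eq_zero]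
  intro p q r hs h0
  rw [hP.eq_barycentric, hQ.eq_barycentric, hR.eq_barycentric] at h0
  have hS := hP.barycentric_sum
  have hS' := hQ.barycentric_sum
  have hS'' := hR.barycentric_sum
  have hSne := hP.sum_ne_zero
  have hSne' := hQ.sum_ne_zero
  have hSne'' := hR.sum_ne_zero
  generalize dist B C * x + dist C A * y + dist A B * z = S at *
  generalize dist B C * x' + dist C A * y' + dist A B * z' = S' at *
  generalize dist B C * x'' + dist C A * y'' + dist A B * z'' = S'' at *
  obtain ⟨hx, hy, hz⟩ := eq_zero_of_side_weights hi
    (x := p / S * x + q / S' * x' + r / S'' * x'')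
    (y := p / S * y + q / S' * y' + r / S'' * y'')
    (z := p / S * z + q / S' * z' + r / S'' * z'')
    (by linear_combination p * hS + q * hS' + r * hS'' + hs) (by rw [← h0]; module)
  rw [add_assoc] at hx hy hz
  have hv : ![p / S, q / S', r / S''] = 0 := Matrix.eq_zero_of_vecMul_eq_zero hdet (by
    ext i
    fin_cases i <;> simpa [Matrix.vecMul, Fin.sum_univ_three])
  simpa [hSne, hSne', hSne''] using hv

theorem ne_of_mul_ne_mul (hi : AffineIndependent ℝ ![A, B, C]) (hP : HasTrilinears A B C P x y z)
    (hQ : HasTrilinears A B C Q x' y' z') (h : x * y' ≠ y * x') : P ≠ Q := by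
  rintro rfl
  exact h (hP.mul_eq_mul hi hQ)

theorem ne_of_neg_of_pos (hi : AffineIndependent ℝ ![A, B, C]) (hP : HasTrilinears A B C P x y z)
    (hQ : HasTrilinears A B C Q x' y' z') (hx : x < 0) (hy : 0 < y) (hx' : 0 < x') (hy' : 0 < y') :
    P ≠ Q :=
  hP.ne_of_mul_ne_mul hi hQ ((mul_neg_of_neg_of_pos hx hy').trans (mul_pos hy hx')).ne

theorem vertex_ne (hi : AffineIndependent ℝ ![A, B, C]) (hP : HasTrilinears A B C P x y z)
    (h : y ≠ 0 ∨ z ≠ 0) : A ≠ P := by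
  have hA := vertex (A := A) (dist_pos.mp (side_pos hi).1)
  exact h.elim (fun hy => hA.ne_of_mul_ne_mul hi hP (by simpa using hy))
    fun hz => hA.swap.ne_of_mul_ne_mul hi.comm_right hP.swap (by simpa using hz)

theorem mem_line_vertex (hP : HasTrilinears A B C P x y z)
    (hQ : HasTrilinears A B C Q x' (t * y) (t * z)) : Q ∈ line[ℝ, A, P] := by
  have hQ' := hQ.smul_eq
  set S := dist B C * x + dist C A * y + dist A B * z with hS
  set S' := dist B C * x' + dist C A * (t * y) + dist A B * (t * z) with hS'
  have hSne' : S' ≠ 0 := hQ.sum_ne_zero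
  rw [mem_affineSpan_pair_iff_exists_lineMap_eq]
  refine ⟨t * S / S', smul_right_injective E hSne' ?_⟩
  dsimp only
  rw [AffineMap.lineMap_apply_module, smul_add, smul_smul, smul_smul, mul_sub,
    mul_div_cancel₀ _ hSne', hQ', mul_smul t S, hP.smul_eq, hS', hS]
  module

end HasTrilinears

/-- The left-hand side of the trilinear equation of a circle relative to a triangle with side
lengths `a, b, c`. The circle with this equation has power `-(b * c * l / k)` at `A`, and likewise
at `B` and `C`; for `l = m = n = 0` it is the circumcircle. -/
def circleForm {R : Type*} [CommRing R] (a b c k l m n x y z : R) : R :=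
  (l * x + m * y + n * z) * (a * x + b * y + c * z) + k * (a * y * z + b * z * x + c * x * y)

/-- `circleForm BC CA AB k l m n x y z = 0` is the equation of the circle `ω` in trilinear
coordinates relative to the triangle `A B C`. The power of a point is recorded rather than mere
incidence, so that radical lines can be read off. -/
structure HasTrilinearEquation {E : Type*} [NormedAddCommGroup E] [NormedSpace ℝ E] (A B C : E)
    (ω : Sphere E) (k l m n : ℝ) : Prop where
  radius_nonneg : 0 ≤ ω.radius
  ne_zero : k ≠ 0
  power_eq : ∀ {P : E} {x y z : ℝ}, HasTrilinears A B C P x y z →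
    k * (dist B C * x + dist C A * y + dist A B * z) ^ 2 * ω.power P =
      -(dist B C * dist C A * dist A B *
        circleForm (dist B C) (dist C A) (dist A B) k l m n x y z)

namespace HasTrilinearEquation

section NormedSpace

variable {E : Type*} [NormedAddCommGroup E] [NormedSpace ℝ E] {A B C P : E}
  {ω ω' : Sphere E} {k l m n l' m' n' x y z : ℝ}

theorem mem_of_circleForm_eq_zero (hω : HasTrilinearEquation A B C ω k l m n)
    (hP : HasTrilinears A B C P x y z)
    (h0 : circleForm (dist B C) (dist C A) (dist A B) k l m n x y z = 0) : P ∈ ω := by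
  rw [← Sphere.power_eq_zero_iff_mem_sphere hω.radius_nonneg]
  have h := hω.power_eq hP
  rw [h0, mul_zero, neg_zero] at h
  exact (mul_eq_zero.mp h).resolve_left (mul_ne_zero hω.ne_zero (pow_ne_zero 2 hP.sum_ne_zero))

theorem power_sub_power_eq (hω : HasTrilinearEquation A B C ω k l m n)
    (hω' : HasTrilinearEquation A B C ω' k l' m' n') (hP : HasTrilinears A B C P x y z) :
    k * (dist B C * x + dist C A * y + dist A B * z) * (ω.power P - ω'.power P) =
      -(dist B C * dist C A * dist A B * ((l - l') * x + (m - m') * y + (n - n') * z)) := by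
  refine mul_left_cancel₀ hP.sum_ne_zero ?_
  have h := hω.power_eq hP
  have h' := hω'.power_eq hP
  unfold circleForm at h h'
  linear_combination h - h'

theorem power_eq_power_iff (hi : AffineIndependent ℝ ![A, B, C])
    (hω : HasTrilinearEquation A B C ω k l m n) (hω' : HasTrilinearEquation A B C ω' k l' m' n')
    (hP : HasTrilinears A B C P x y z) :
    ω.power P = ω'.power P ↔ (l - l') * x + (m - m') * y + (n - n') * z = 0 := by
  obtain ⟨ha, hb, hc⟩ := side_pos hi
  have h := hω.power_sub_power_eq hω' hP
  rw [← sub_eq_zero, ← mul_right_inj' (mul_ne_zero hω.ne_zero hP.sum_ne_zero), h, mul_zero,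
    neg_eq_zero, mul_eq_zero, or_iff_right (by positivity)]

end NormedSpace

theorem exists_of_circleForm_eq_zero {E : Type*} [NormedAddCommGroup E]
    [InnerProductSpace ℝ E] {A B C P : E} {k l m n x y z : ℝ} [FiniteDimensional ℝ E]
    (hE : Module.finrank ℝ E = 2)
    (hi : AffineIndependent ℝ ![A, B, C]) (hk : k ≠ 0) (hP : HasTrilinears A B C P x y z)
    (h0 : circleForm (dist B C) (dist C A) (dist A B) k l m n x y z = 0) :
    ∃ ω, HasTrilinearEquation A B C ω k l m n := by
  have hS := hP.sum_ne_zero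
  obtain ⟨ω, hr, hA, hB, hC⟩ := exists_sphere_power_eq hE hi (-(dist C A * dist A B * l / k))
    (-(dist A B * dist B C * m / k)) (-(dist B C * dist C A * n / k)) hP.barycentric_sum (by
      unfold circleForm at h0
      generalize dist B C * x + dist C A * y + dist A B * z = S at *
      field_simp
      linear_combination -(dist B C * dist C A * dist A B) * h0)
  refine ⟨ω, hr, hk, fun {Q x' y' z'} hQ => ?_⟩
  have hS' := hQ.sum_ne_zero
  have hpow := power_barycentric (A := A) (B := B) (C := C) ω hQ.barycentric_sum
  rw [← hQ.eq_barycentric, hA, hB, hC] at hpow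
  rw [hpow, circleForm]
  generalize dist B C * x' + dist C A * y' + dist A B * z' = S at *
  field_simp
  ring

end HasTrilinearEquation

theorem eq_smul_of_angle_trisector {E : Type*} [NormedAddCommGroup E] [InnerProductSpace ℝ E]
    {p q x : E} {t : ℝ} (hp : p ≠ 0) (hq : q ≠ 0)
    (hpq : InnerProductGeometry.angle p q = 3 * t)
    (hpx : InnerProductGeometry.angle p x = t) (hxq : InnerProductGeometry.angle x q = 2 * t)
    (ht : 3 * t < Real.pi) :
    ∃ r : ℝ, x = r • ((2 * Real.cos t / ‖p‖) • p + (1 / ‖q‖) • q) := by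
  have ht0 : 0 ≤ t := hpx ▸ InnerProductGeometry.angle_nonneg p x
  have hc : 1 / 2 < Real.cos t := by
    rw [← Real.cos_pi_div_three]
    exact Real.cos_lt_cos_of_nonneg_of_le_pi ht0 (by linarith [Real.pi_pos]) (by linarith)
  set c := Real.cos t
  have hk : 4 * c ^ 2 - 1 ≠ 0 := by nlinarith
  have hp' : ‖p‖ ≠ 0 := norm_ne_zero_iff.mpr hp
  have hq' : ‖q‖ ≠ 0 := norm_ne_zero_iff.mpr hq
  have inner_px : ⟪p, x⟫ = c * (‖p‖ * ‖x‖) := by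
    rw [← InnerProductGeometry.cos_angle_mul_norm_mul_norm, hpx]
  have inner_xq : ⟪x, q⟫ = (2 * c ^ 2 - 1) * (‖x‖ * ‖q‖) := by
    rw [← InnerProductGeometry.cos_angle_mul_norm_mul_norm, hxq, Real.cos_two_mul]
  have inner_pq : ⟪p, q⟫ = (4 * c ^ 3 - 3 * c) * (‖p‖ * ‖q‖) := by
    rw [← InnerProductGeometry.cos_angle_mul_norm_mul_norm, hpq, Real.cos_three_mul]
  refine ⟨‖x‖ / (4 * c ^ 2 - 1), ?_⟩
  -- The Gram matrix of `p, q, x` is known, so the difference of the two sides has norm zero.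
  rw [← sub_eq_zero, ← inner_self_eq_zero (𝕜 := ℝ)]
  simp only [inner_sub_left, inner_sub_right, inner_add_left, inner_add_right,
    real_inner_smul_left, real_inner_smul_right, real_inner_comm p x, real_inner_comm x q,
    real_inner_comm p q]
  simp only [real_inner_self_eq_norm_sq, inner_px, inner_xq, inner_pq]
  field_simp
  ring

theorem HasTrilinears.mul_eq_mul_of_sub_eq_smul {E : Type*} [NormedAddCommGroup E]
    [NormedSpace ℝ E] {A B C P : E} {x y z p q r : ℝ} (hi : AffineIndependent ℝ ![A, B, C])
    (h : HasTrilinears A B C P x y z)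
    (hr : P - A = r • ((p / dist A B) • (B - A) + (q / dist C A) • (C - A))) : y * q = z * p := by
  obtain ⟨-, hb, hc⟩ := side_pos hi
  set S := dist B C * x + dist C A * y + dist A B * z with hS
  obtain ⟨-, hy, hz⟩ := affineIndependent_iff_barycentric_eq_zero.mp hi
    (dist B C * x - S + S * r * (p / dist A B) + S * r * (q / dist C A))
    (dist C A * y - S * r * (p / dist A B)) (dist A B * z - S * r * (q / dist C A))
    (by rw [hS]; ring) (by
      have hSP : S • (P - A) = _ := congrArg (S • ·) hr
      rw [smul_sub, h.smul_eq, ← sub_eq_zero] at hSP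
      rw [← hSP]
      module)
  field_simp at hy hz
  refine mul_left_cancel₀ (mul_pos hb hc).ne' ?_
  linear_combination q * hy - p * hz

theorem pointReflection_sub {V : Type*} [AddCommGroup V] [Module ℝ V] (A C : V) :
    AffineEquiv.pointReflection ℝ A C - A = -(C - A) := by
  rw [neg_sub]
  exact Equiv.pointReflection_vsub_left A C

theorem dist_pointReflection {V : Type*} [NormedAddCommGroup V] [NormedSpace ℝ V] (A C : V) :
    dist (AffineEquiv.pointReflection ℝ A C) A = dist C A := by
  rw [dist_comm C]
  exact dist_pointReflection_left A C

namespace OnTrisector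

variable {A B C P Q V X : Plane} {x y z : ℝ}

theorem exists_sub_eq_smul (h : OnTrisector P V Q X) (hP : P ≠ V) (hQ : Q ≠ V)
    (hlt : ∠ P V Q < Real.pi) :
    ∃ r : ℝ, X - V = r • ((2 * Real.cos (∠ P V Q / 3) / dist P V) • (P - V) +
      (1 / dist Q V) • (Q - V)) := by
  obtain ⟨-, hPX, hXQ⟩ := h
  rw [dist_eq_norm, dist_eq_norm]
  exact eq_smul_of_angle_trisector (sub_ne_zero.mpr hP) (sub_ne_zero.mpr hQ)
    (by rw [mul_div_cancel₀ _ three_ne_zero]; rfl) hPX (by rw [← mul_div_assoc, ← hXQ]; rfl)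
    (by rwa [mul_div_cancel₀ _ three_ne_zero])

theorem trilinear_eq (hi : AffineIndependent ℝ ![A, B, C]) (hX : HasTrilinears A B C X x y z)
    (h : OnTrisector B A C X) : y = 2 * Real.cos (∠ B A C / 3) * z := by
  have hc := affineIndependent_iff_not_collinear_set.mp hi.comm_left
  obtain ⟨r, hr⟩ := h.exists_sub_eq_smul (ne₁₂_of_not_collinear hc) (ne₂₃_of_not_collinear hc).symm
    (angle_lt_pi_of_not_collinear hc)
  rw [dist_comm B A] at hr
  linarith [hX.mul_eq_mul_of_sub_eq_smul hi hr]

theorem trilinear_eq_of_pointReflection_right (hi : AffineIndependent ℝ ![A, B, C])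
    (hX : HasTrilinears A B C X x y z)
    (h : OnTrisector B A (AffineEquiv.pointReflection ℝ A C) X) :
    y = -(2 * Real.cos ((Real.pi - ∠ B A C) / 3) * z) := by
  have hc := affineIndependent_iff_not_collinear_set.mp hi.comm_left
  obtain ⟨r, hr⟩ := h.exists_sub_eq_smul (ne₁₂_of_not_collinear hc)
    (by rw [← dist_pos, dist_pointReflection]; exact dist_pos.mpr (ne₂₃_of_not_collinear hc).symm)
    (by rw [angle_pointReflection_right]; linarith [angle_pos_of_not_collinear hc])
  rw [angle_pointReflection_right, dist_comm B A, dist_pointReflection, pointReflection_sub,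
    smul_neg, ← neg_smul, ← neg_div] at hr
  linarith [hX.mul_eq_mul_of_sub_eq_smul hi hr]

theorem trilinear_eq_of_pointReflection_left (hi : AffineIndependent ℝ ![A, B, C])
    (hX : HasTrilinears A B C X x y z)
    (h : OnTrisector (AffineEquiv.pointReflection ℝ A C) A B X) :
    z = -(2 * Real.cos ((Real.pi - ∠ B A C) / 3) * y) := by
  have hc := affineIndependent_iff_not_collinear_set.mp hi.comm_left
  obtain ⟨r, hr⟩ := h.exists_sub_eq_smul
    (by rw [← dist_pos, dist_pointReflection]; exact dist_pos.mpr (ne₂₃_of_not_collinear hc).symm)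
    (ne₁₂_of_not_collinear hc)
    (by rw [angle_comm, angle_pointReflection_right]; linarith [angle_pos_of_not_collinear hc])
  rw [angle_comm, angle_pointReflection_right, dist_comm B A, dist_pointReflection,
    pointReflection_sub, smul_neg, ← neg_smul, ← neg_div, add_comm] at hr
  linarith [hX.mul_eq_mul_of_sub_eq_smul hi hr]

end OnTrisector

/-- The elements `vᵢ + uᵢ ω` of `R[ω]`, where `ω ^ 2 = ω - 1`, have norm one and product `ω`. For
`R = ℝ` these are three points `exp (i αᵢ)` of the unit circle with `α₁ + α₂ + α₃ = π / 3`, written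
in the oblique basis `1, exp (i π / 3)`, in which all Morley quantities are integral polynomials. -/
structure HexTriple {R : Type*} [CommRing R] (u₁ v₁ u₂ v₂ u₃ v₃ : R) : Prop where
  norm₁ : u₁ ^ 2 + u₁ * v₁ + v₁ ^ 2 = 1
  norm₂ : u₂ ^ 2 + u₂ * v₂ + v₂ ^ 2 = 1
  u₃_eq : u₃ = v₁ * v₂ - u₁ * u₂
  v₃_eq : v₃ = u₁ * v₂ + u₁ * u₂ + v₁ * u₂

namespace HexTriple

variable {R : Type*} [CommRing R] {u₁ v₁ u₂ v₂ u₃ v₃ : R}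

theorem norm₃ (h : HexTriple u₁ v₁ u₂ v₂ u₃ v₃) : u₃ ^ 2 + u₃ * v₃ + v₃ ^ 2 = 1 := by
  rw [h.u₃_eq, h.v₃_eq]
  linear_combination (u₂ ^ 2 + u₂ * v₂ + v₂ ^ 2) * h.norm₁ + h.norm₂

theorem rotate (h : HexTriple u₁ v₁ u₂ v₂ u₃ v₃) : HexTriple u₂ v₂ u₃ v₃ u₁ v₁ where
  norm₁ := h.norm₂
  norm₂ := h.norm₃
  u₃_eq := by
    rw [h.u₃_eq, h.v₃_eq]
    linear_combination -u₁ * h.norm₂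
  v₃_eq := by
    rw [h.u₃_eq, h.v₃_eq]
    linear_combination -v₁ * h.norm₂

theorem swap (h : HexTriple u₁ v₁ u₂ v₂ u₃ v₃) : HexTriple u₁ v₁ u₃ v₃ u₂ v₂ where
  norm₁ := h.norm₁
  norm₂ := h.norm₃
  u₃_eq := by linear_combination h.rotate.rotate.u₃_eq
  v₃_eq := by linear_combination h.rotate.rotate.v₃_eq

-- The first index names the circle, `(A_A A_B A_C)` or `(C_A B_A B_B C_C)`, and the second one
-- the kind of Morley vertex, in the order of `IsExternalMorleyTriangle`, at which its form is
-- evaluated.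
theorem circleForm_fst_fst (h : HexTriple u₁ v₁ u₂ v₂ u₃ v₃) :
    circleForm (u₁ * v₁ * (u₁ + v₁)) (u₂ * v₂ * (u₂ + v₂)) (u₃ * v₃ * (u₃ + v₃))
      (u₁ + v₁) ((u₁ + v₁) ^ 2) (v₁ * v₂) (v₁ * v₃) (-1) (2 * u₃ + v₃) (2 * u₂ + v₂) = 0 := by
  obtain ⟨e₁, e₂, rfl, rfl⟩ := h
  unfold circleForm
  grind

theorem circleForm_fst_trd (h : HexTriple u₁ v₁ u₂ v₂ u₃ v₃) :
    circleForm (u₁ * v₁ * (u₁ + v₁)) (u₂ * v₂ * (u₂ + v₂)) (u₃ * v₃ * (u₃ + v₃))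
      (u₁ + v₁) ((u₁ + v₁) ^ 2) (v₁ * v₂) (v₁ * v₃) (2 * v₂ + u₂) (-(2 * u₁ + v₁)) 1 = 0 := by
  obtain ⟨e₁, e₂, rfl, rfl⟩ := h
  unfold circleForm
  grind

theorem circleForm_snd_snd (h : HexTriple u₁ v₁ u₂ v₂ u₃ v₃) :
    circleForm (u₁ * v₁ * (u₁ + v₁)) (u₂ * v₂ * (u₂ + v₂)) (u₃ * v₃ * (u₃ + v₃))
      (u₁ + v₁) 0 v₃ v₂ (-(2 * u₂ + v₂)) (2 * v₁ + u₁) 1 = 0 := by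
  obtain ⟨e₁, e₂, rfl, rfl⟩ := h
  unfold circleForm
  grind

theorem circleForm_snd_fst (h : HexTriple u₁ v₁ u₂ v₂ u₃ v₃) :
    circleForm (u₁ * v₁ * (u₁ + v₁)) (u₂ * v₂ * (u₂ + v₂)) (u₃ * v₃ * (u₃ + v₃))
      (u₁ + v₁) 0 v₃ v₂ (2 * u₃ + v₃) (-1) (2 * u₁ + v₁) = 0 := by
  obtain ⟨e₁, e₂, rfl, rfl⟩ := h
  unfold circleForm
  grind

theorem three_mul_add_sq (h : HexTriple u₁ v₁ u₂ v₂ u₃ v₃) :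
    3 * (u₁ + v₁) ^ 2 = 4 - (v₁ - u₁) ^ 2 := by
  linear_combination 4 * h.norm₁

theorem three_mul_sub (h : HexTriple u₁ v₁ u₂ v₂ u₃ v₃) :
    3 * (v₁ * v₂ - v₃) = (v₁ - u₁) * (v₂ - u₂) - 2 * (v₃ - u₃) := by
  linear_combination -2 * h.u₃_eq - h.v₃_eq

end HexTriple

/-- The real numbers `hexU t` and `hexV t` are the coordinates of a point of the unit circle in an
oblique basis: `exp (i t) = hexV t + hexU t * exp (i π / 3)`. -/
noncomputable def hexU (t : ℝ) : ℝ := 2 * Real.sin t / √3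

/-- The companion of `hexU`: its reflection in `π / 6`. -/
noncomputable def hexV (t : ℝ) : ℝ := hexU (Real.pi / 3 - t)

/-- The cosine of `π / 3 + t`. For `t` a third of an angle of a triangle, these numbers are the
coefficients in the trilinear coordinates of the triangle formed by the radical lines. -/
noncomputable def morleyCos (t : ℝ) : ℝ := Real.cos (Real.pi / 3 + t)

section HexCoordinates

variable {s t α β γ : ℝ}

theorem hexV_pi_div_three_sub (t : ℝ) : hexV (Real.pi / 3 - t) = hexU t :=
  congrArg hexU (sub_sub_cancel _ t)

theorem hexU_pos (h0 : 0 < t) (h : t < Real.pi / 3) : 0 < hexU t := by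
  have := Real.sin_pos_of_pos_of_lt_pi h0 (by linarith)
  unfold hexU
  positivity

theorem hexV_pos (h0 : 0 < t) (h : t < Real.pi / 3) : 0 < hexV t :=
  hexU_pos (by linarith) (by linarith)

theorem sin_eq_hexU (t : ℝ) : Real.sin t = √3 / 2 * hexU t := by
  unfold hexU
  field_simp

theorem cos_eq_hexV_add_hexU (t : ℝ) : Real.cos t = hexV t + hexU t / 2 := by
  rw [hexV, hexU, hexU, Real.sin_sub, Real.sin_pi_div_three, Real.cos_pi_div_three]
  field_simp
  ring

theorem two_mul_cos_eq (t : ℝ) : 2 * Real.cos t = 2 * hexV t + hexU t := by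
  rw [cos_eq_hexV_add_hexU]
  ring

theorem two_mul_cos_pi_div_three_sub (t : ℝ) :
    2 * Real.cos (Real.pi / 3 - t) = 2 * hexU t + hexV t := by
  rw [two_mul_cos_eq, hexV_pi_div_three_sub, hexV]

theorem morleyCos_eq (t : ℝ) : morleyCos t = (hexV t - hexU t) / 2 := by
  have h := Real.cos_add_cos (Real.pi / 3 + t) (Real.pi / 3 - t)
  rw [show (Real.pi / 3 + t + (Real.pi / 3 - t)) / 2 = Real.pi / 3 by ring,
    show (Real.pi / 3 + t - (Real.pi / 3 - t)) / 2 = t by ring, Real.cos_pi_div_three] at h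
  unfold morleyCos
  linear_combination h + two_mul_cos_eq t / 2 - two_mul_cos_pi_div_three_sub t / 2

theorem hexU_sq_add (t : ℝ) : hexU t ^ 2 + hexU t * hexV t + hexV t ^ 2 = 1 := by
  have h := Real.sin_sq_add_cos_sq t
  rw [sin_eq_hexU, cos_eq_hexV_add_hexU, mul_pow, div_pow, Real.sq_sqrt zero_le_three] at h
  linear_combination h

theorem hexU_add (s t : ℝ) :
    hexU (s + t) = hexU s * hexV t + hexU s * hexU t + hexV s * hexU t := by
  have h : √3 / 2 * hexU (s + t) = √3 / 2 * (hexU s * Real.cos t + Real.cos s * hexU t) := by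
    rw [← sin_eq_hexU, Real.sin_add, sin_eq_hexU, sin_eq_hexU]
    ring
  rw [mul_left_cancel₀ (by positivity) h, cos_eq_hexV_add_hexU, cos_eq_hexV_add_hexU]
  ring

theorem hexV_add (s t : ℝ) : hexV (s + t) = hexV s * hexV t - hexU s * hexU t := by
  have h := Real.cos_add s t
  simp only [sin_eq_hexU, cos_eq_hexV_add_hexU, hexU_add] at h
  linear_combination h - hexU s * hexU t / 4 * Real.sq_sqrt zero_le_three

theorem sin_three_mul_eq_hexU (t : ℝ) :
    Real.sin (3 * t) = 3 * √3 / 2 * (hexU t * hexV t * (hexU t + hexV t)) := by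
  rw [sin_eq_hexU, show 3 * t = t + t + t by ring, hexU_add, hexU_add, hexV_add]
  ring

theorem hexTriple_of_add_eq (h : α + β + γ = Real.pi / 3) :
    HexTriple (hexU α) (hexV α) (hexU β) (hexV β) (hexU γ) (hexV γ) := by
  obtain rfl : γ = Real.pi / 3 - (α + β) := by linarith
  exact ⟨hexU_sq_add α, hexU_sq_add β, hexV_add α β,
    by rw [hexV_pi_div_three_sub]; exact hexU_add α β⟩

theorem abs_morleyCos_lt_half (h0 : 0 < t) (h : t < Real.pi / 3) : |morleyCos t| < 1 / 2 := by
  unfold morleyCos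
  have := Real.pi_pos
  have hlt := Real.cos_lt_cos_of_nonneg_of_le_pi (x := Real.pi / 3) (y := Real.pi / 3 + t)
    (by linarith) (by linarith) (by linarith)
  have hgt := Real.cos_lt_cos_of_nonneg_of_le_pi (x := Real.pi / 3 + t)
    (y := Real.pi - Real.pi / 3) (by linarith) (by linarith) (by linarith)
  rw [Real.cos_pi_sub, Real.cos_pi_div_three] at hgt
  rw [Real.cos_pi_div_three] at hlt
  exact abs_lt.mpr ⟨by linarith, hlt⟩

theorem morleyCos_add_morleyCos_pos (hs : 0 < s) (ht : 0 < t) (h : s + t < Real.pi / 3) :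
    0 < morleyCos s + morleyCos t := by
  have hlt := Real.cos_lt_cos_of_nonneg_of_le_pi (x := Real.pi / 3 + s)
    (y := Real.pi - (Real.pi / 3 + t)) (by linarith) (by linarith) (by linarith)
  rw [Real.cos_pi_sub] at hlt
  unfold morleyCos
  linarith

theorem morleyCos_add_two_mul (h : α + β + γ = Real.pi / 3) :
    morleyCos α + 2 * (morleyCos β * morleyCos γ) = 2 * (Real.sin β * Real.sin γ) := by
  have hT := (hexTriple_of_add_eq h).rotate
  rw [morleyCos_eq, morleyCos_eq, morleyCos_eq, sin_eq_hexU, sin_eq_hexU, hT.u₃_eq, hT.v₃_eq]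
  linear_combination -(hexU β * hexU γ) / 2 * Real.sq_sqrt zero_le_three

theorem cos_three_mul_eq_morleyCos (t : ℝ) :
    Real.cos (3 * t) = morleyCos t * (3 - 4 * morleyCos t ^ 2) := by
  have h := Real.cos_three_mul (Real.pi / 3 + t)
  rw [show 3 * (Real.pi / 3 + t) = 3 * t + Real.pi by ring, Real.cos_add_pi] at h
  unfold morleyCos
  linear_combination -h

end HexCoordinates

/-- The angles of the nondegenerate triangle `A B C` are `3 α, 3 β, 3 γ`. -/
structure HasThirdAngles {E : Type*} [NormedAddCommGroup E] [InnerProductSpace ℝ E] (A B C : E)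
    (α β γ : ℝ) : Prop where
  affineIndependent : AffineIndependent ℝ ![A, B, C]
  angle_fst : ∠ B A C = 3 * α
  angle_snd : ∠ C B A = 3 * β
  angle_trd : ∠ A C B = 3 * γ

namespace HasThirdAngles

variable {E : Type*} [NormedAddCommGroup E] [InnerProductSpace ℝ E] {A B C : E} {α β γ : ℝ}

theorem exists_of_affineIndependent (h : AffineIndependent ℝ ![A, B, C]) :
    ∃ α β γ, HasThirdAngles A B C α β γ :=
  ⟨∠ B A C / 3, ∠ C B A / 3, ∠ A C B / 3, h, by ring, by ring, by ring⟩

theorem rotate (h : HasThirdAngles A B C α β γ) : HasThirdAngles B C A β γ α :=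
  ⟨h.affineIndependent.comm_left.comm_right, h.angle_snd, h.angle_trd, h.angle_fst⟩

theorem swap (h : HasThirdAngles A B C α β γ) : HasThirdAngles A C B α γ β :=
  ⟨h.affineIndependent.comm_right, by rw [angle_comm, h.angle_fst],
    by rw [angle_comm, h.angle_trd], by rw [angle_comm, h.angle_snd]⟩

theorem pos (h : HasThirdAngles A B C α β γ) : 0 < α := by
  have := angle_pos_of_not_collinear
    (affineIndependent_iff_not_collinear_set.mp h.affineIndependent.comm_left)
  linarith [h.angle_fst]

theorem add_eq (h : HasThirdAngles A B C α β γ) : α + β + γ = Real.pi / 3 := by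
  have := angle_add_angle_add_angle_eq_pi C (dist_pos.mp (side_pos h.affineIndependent).2.2).symm
  rw [angle_comm A B C, angle_comm B C A, angle_comm C A B] at this
  linarith [h.angle_fst, h.angle_snd, h.angle_trd]

theorem lt (h : HasThirdAngles A B C α β γ) : α < Real.pi / 3 := by
  linarith [h.add_eq, h.rotate.pos, h.rotate.rotate.pos]

theorem hex_pos (h : HasThirdAngles A B C α β γ) : 0 < hexU α ∧ 0 < hexV α :=
  ⟨hexU_pos h.pos h.lt, hexV_pos h.pos h.lt⟩

theorem exists_dist_eq (h : HasThirdAngles A B C α β γ) : ∃ d,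
    dist B C = d * Real.sin (3 * α) ∧ dist C A = d * Real.sin (3 * β) ∧
      dist A B = d * Real.sin (3 * γ) := by
  have hα : 0 < Real.sin (3 * α) :=
    Real.sin_pos_of_pos_of_lt_pi (by linarith [h.pos]) (by linarith [h.lt])
  have hB := law_sin B A C
  have hC := law_sin C A B
  rw [h.angle_fst, h.angle_snd, dist_comm A C, dist_comm C B] at hB
  rw [angle_comm C, h.angle_fst, angle_comm B, h.angle_trd] at hC
  refine ⟨dist B C / Real.sin (3 * α), ?_, ?_, ?_⟩ <;> field_simp <;> linarith

theorem exists_dist_eq_hex (h : HasThirdAngles A B C α β γ) : ∃ d,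
    dist B C = d * (hexU α * hexV α * (hexU α + hexV α)) ∧
      dist C A = d * (hexU β * hexV β * (hexU β + hexV β)) ∧
      dist A B = d * (hexU γ * hexV γ * (hexU γ + hexV γ)) := by
  obtain ⟨d, ha, hb, hc⟩ := h.exists_dist_eq
  simp only [sin_three_mul_eq_hexU, ← mul_assoc d] at ha hb hc
  exact ⟨_, ha, hb, hc⟩

theorem dist_eq_add (h : HasThirdAngles A B C α β γ) :
    dist B C = dist C A * Real.cos (3 * γ) + dist A B * Real.cos (3 * β) := by
  obtain ⟨d, ha, hb, hc⟩ := h.exists_dist_eq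
  rw [ha, hb, hc, show 3 * α = Real.pi - (3 * β + 3 * γ) by linarith [h.add_eq], Real.sin_pi_sub,
    Real.sin_add]
  ring

end HasThirdAngles

namespace IsExternalMorleyTriangle

variable {A B C X Y Z : Plane} {α β γ : ℝ}

theorem swap (h : IsExternalMorleyTriangle A B C X Y Z) : IsExternalMorleyTriangle A C B X Z Y :=
  ⟨h.fst_C, h.fst_B, h.trd_A, h.trd_C, h.snd_A, h.snd_B⟩

theorem hasTrilinears_fst (hM : IsExternalMorleyTriangle A B C X Y Z)
    (h : HasThirdAngles A B C α β γ) :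
    HasTrilinears A B C X (-1) (2 * hexU γ + hexV γ) (2 * hexU β + hexV β) := by
  obtain ⟨x, y, z, hX⟩ :=
    HasTrilinears.exists_of_affineIndependent finrank_euclideanSpace_fin h.affineIndependent X
  have hy := hM.fst_C.trilinear_eq_of_pointReflection_right
    h.rotate.rotate.swap.affineIndependent hX.rotate.rotate.swap
  have hz := hM.fst_B.trilinear_eq_of_pointReflection_right h.rotate.affineIndependent hX.rotate
  rw [h.rotate.rotate.swap.angle_fst, sub_div, mul_div_cancel_left₀ _ three_ne_zero,
    two_mul_cos_pi_div_three_sub] at hy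
  rw [h.rotate.angle_fst, sub_div, mul_div_cancel_left₀ _ three_ne_zero,
    two_mul_cos_pi_div_three_sub] at hz
  refine HasTrilinears.of_mul (t := -x) ?_
  convert hX using 1 <;> linarith

theorem hasTrilinears_snd (hM : IsExternalMorleyTriangle A B C X Y Z)
    (h : HasThirdAngles A B C α β γ) :
    HasTrilinears A B C Y (-(2 * hexU β + hexV β)) (2 * hexV α + hexU α) 1 := by
  obtain ⟨x, y, z, hY⟩ :=
    HasTrilinears.exists_of_affineIndependent finrank_euclideanSpace_fin h.affineIndependent Y
  have hx := hM.snd_B.trilinear_eq_of_pointReflection_left h.rotate.affineIndependent hY.rotate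
  have hy := hM.snd_A.trilinear_eq h.affineIndependent hY
  rw [h.rotate.angle_fst, sub_div, mul_div_cancel_left₀ _ three_ne_zero,
    two_mul_cos_pi_div_three_sub] at hx
  rw [h.angle_fst, mul_div_cancel_left₀ _ three_ne_zero, two_mul_cos_eq] at hy
  refine HasTrilinears.of_mul (t := z) ?_
  convert hY using 1 <;> linarith

theorem hasTrilinears_trd (hM : IsExternalMorleyTriangle A B C X Y Z)
    (h : HasThirdAngles A B C α β γ) :
    HasTrilinears A B C Z (-(2 * hexU γ + hexV γ)) 1 (2 * hexV α + hexU α) :=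
  (hM.swap.hasTrilinears_snd h.swap).swap

end IsExternalMorleyTriangle

theorem isCircleThrough_of_three {ω : Sphere Plane} {s : Set Plane} (hs : s ⊆ ω) {P Q R : Plane}
    (hP : P ∈ s) (hQ : Q ∈ s) (hR : R ∈ s) (hPQ : P ≠ Q) (hPR : P ≠ R) (hQR : Q ≠ R) :
    IsCircleThrough ω s := by
  refine ⟨hs, fun ω' hs' => by_contra fun hne => ?_⟩
  have : Fact (Module.finrank ℝ Plane = 2) := ⟨finrank_euclideanSpace_fin⟩
  exact (eq_of_mem_sphere_of_mem_sphere_of_finrank_eq_two finrank_euclideanSpace_fin hne hPQ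
    (hs' hP) (hs' hQ) (hs' hR) (hs hP) (hs hQ) (hs hR)).elim hPR.symm hQR.symm

theorem isCircleThrough_of_hasTrilinears {ω : Sphere Plane} {s : Set Plane} (hs : s ⊆ ω)
    {A B C P Q R : Plane} {x y z x' y' z' x'' y'' z'' : ℝ} (hi : AffineIndependent ℝ ![A, B, C])
    (hP : HasTrilinears A B C P (-x) y z) (hQ : HasTrilinears A B C Q x' (-y') z')
    (hR : HasTrilinears A B C R x'' y'' (-z'')) (hPs : P ∈ s) (hQs : Q ∈ s) (hRs : R ∈ s)
    (hx : 0 < x) (hy : 0 < y) (hz : 0 < z) (hx' : 0 < x') (hy' : 0 < y') (hz' : 0 < z')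
    (hx'' : 0 < x'') (hy'' : 0 < y'') : IsCircleThrough ω s :=
  isCircleThrough_of_three hs hPs hQs hRs
    (hP.swap.ne_of_neg_of_pos hi.comm_right hQ.swap (by linarith) hz hx' hz')
    (hP.ne_of_neg_of_pos hi hR (by linarith) hy hx'' hy'')
    (hQ.rotate.swap.ne_of_neg_of_pos hi.comm_left hR.rotate.swap (by linarith) hx' hy'' hx'')

theorem circleForm_swap {R : Type*} [CommRing R] (a b c k l m n x y z : R) :
    circleForm a c b k l n m x z y = circleForm a b c k l m n x y z := by
  unfold circleForm
  ring

theorem circleForm_mul_side {R : Type*} [CommRing R] (d a b c k l m n x y z : R) :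
    circleForm (d * a) (d * b) (d * c) k l m n x y z = d * circleForm a b c k l m n x y z := by
  unfold circleForm
  ring

theorem HasThirdAngles.circleForm_eq_zero {E : Type*} [NormedAddCommGroup E]
    [InnerProductSpace ℝ E] {A B C : E} {α β γ k l m n x y z : ℝ}
    (h : HasThirdAngles A B C α β γ)
    (h0 : circleForm (hexU α * hexV α * (hexU α + hexV α)) (hexU β * hexV β * (hexU β + hexV β))
      (hexU γ * hexV γ * (hexU γ + hexV γ)) k l m n x y z = 0) :
    circleForm (dist B C) (dist C A) (dist A B) k l m n x y z = 0 := by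
  obtain ⟨d, ha, hb, hc⟩ := h.exists_dist_eq_hex
  rw [ha, hb, hc, circleForm_mul_side, h0, mul_zero]

namespace HasThirdAngles

variable {A B C A_A B_A C_A A_B B_B C_B A_C B_C C_C : Plane} {α β γ : ℝ}

theorem exists_circle_fst (h : HasThirdAngles A B C α β γ)
    (hA : IsExternalMorleyTriangle A B C A_A B_A C_A)
    (hB : IsExternalMorleyTriangle B C A B_B C_B A_B)
    (hC : IsExternalMorleyTriangle C A B C_C A_C B_C) :
    ∃ ω, IsCircleThrough ω {A_A, A_B, A_C} ∧ HasTrilinearEquation A B C ω (hexU α + hexV α)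
      ((hexU α + hexV α) ^ 2) (hexV α * hexV β) (hexV α * hexV γ) := by
  have hT := hexTriple_of_add_eq h.add_eq
  have hi := h.affineIndependent
  obtain ⟨hu₁, hv₁⟩ := h.hex_pos
  obtain ⟨hu₂, hv₂⟩ := h.rotate.hex_pos
  obtain ⟨hu₃, hv₃⟩ := h.rotate.rotate.hex_pos
  have hA_A := hA.hasTrilinears_fst h
  have hA_B := (hB.hasTrilinears_trd h.rotate).rotate.rotate
  have hA_C := (hC.hasTrilinears_snd h.rotate.rotate).rotate
  have hA_A₀ := h.circleForm_eq_zero hT.circleForm_fst_fst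
  have hA_B₀ := h.circleForm_eq_zero hT.circleForm_fst_trd
  have hA_C₀ := h.circleForm_eq_zero
    ((circleForm_swap ..).trans hT.swap.circleForm_fst_trd)
  obtain ⟨ω, hω⟩ := HasTrilinearEquation.exists_of_circleForm_eq_zero finrank_euclideanSpace_fin
    hi (by positivity) hA_A hA_A₀
  refine ⟨ω, isCircleThrough_of_hasTrilinears ?_ hi hA_A hA_B hA_C (by simp) (by simp) (by simp)
    ?_ ?_ ?_ ?_ ?_ ?_ ?_ ?_, hω⟩
  · rintro P (rfl | rfl | rfl)
    exacts [hω.mem_of_circleForm_eq_zero hA_A hA_A₀, hω.mem_of_circleForm_eq_zero hA_B hA_B₀,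
      hω.mem_of_circleForm_eq_zero hA_C hA_C₀]
  all_goals positivity

theorem exists_circle_snd (h : HasThirdAngles A B C α β γ)
    (hA : IsExternalMorleyTriangle A B C A_A B_A C_A)
    (hB : IsExternalMorleyTriangle B C A B_B C_B A_B)
    (hC : IsExternalMorleyTriangle C A B C_C A_C B_C) :
    ∃ ω, IsCircleThrough ω {C_A, B_A, B_B, C_C} ∧
      HasTrilinearEquation A B C ω (hexU α + hexV α) 0 (hexV γ) (hexV β) := by
  have hT := hexTriple_of_add_eq h.add_eq
  have hi := h.affineIndependent
  obtain ⟨hu₁, hv₁⟩ := h.hex_pos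
  obtain ⟨hu₂, hv₂⟩ := h.rotate.hex_pos
  obtain ⟨hu₃, hv₃⟩ := h.rotate.rotate.hex_pos
  have hB_A := hA.hasTrilinears_snd h
  have hC_A := hA.hasTrilinears_trd h
  have hB_B := (hB.hasTrilinears_fst h.rotate).rotate.rotate
  have hC_C := (hC.hasTrilinears_fst h.rotate.rotate).rotate
  have hB_A₀ := h.circleForm_eq_zero hT.circleForm_snd_snd
  have hC_A₀ := h.circleForm_eq_zero ((circleForm_swap ..).trans hT.swap.circleForm_snd_snd)
  have hB_B₀ := h.circleForm_eq_zero hT.circleForm_snd_fst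
  have hC_C₀ := h.circleForm_eq_zero ((circleForm_swap ..).trans hT.swap.circleForm_snd_fst)
  obtain ⟨ω, hω⟩ := HasTrilinearEquation.exists_of_circleForm_eq_zero finrank_euclideanSpace_fin
    hi (by positivity) hB_A hB_A₀
  refine ⟨ω, isCircleThrough_of_hasTrilinears ?_ hi hB_A hB_B hC_C (by simp) (by simp) (by simp)
    ?_ ?_ ?_ ?_ ?_ ?_ ?_ ?_, hω⟩
  · rintro P (rfl | rfl | rfl | rfl)
    exacts [hω.mem_of_circleForm_eq_zero hC_A hC_A₀, hω.mem_of_circleForm_eq_zero hB_A hB_A₀,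
      hω.mem_of_circleForm_eq_zero hB_B hB_B₀, hω.mem_of_circleForm_eq_zero hC_C hC_C₀]
  all_goals positivity

end HasThirdAngles

theorem isRadicalLineOf_line_of_power_eq {s t : Set Plane} {ω₁ ω₂ : Sphere Plane}
    (hs : IsCircleThrough ω₁ s) (ht : IsCircleThrough ω₂ t) {X Y Z P : Plane}
    (hi : AffineIndependent ℝ ![X, Y, Z]) (hY : ω₁.power Y = ω₂.power Y)
    (hZ : ω₁.power Z = ω₂.power Z) (hP : ω₁.power P ≠ ω₂.power P) :
    IsRadicalLineOf line[ℝ, Y, Z] s t := by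
  have hpow {x y z : ℝ} (h : x + y + z = 1) :
      ω₁.power (x • X + y • Y + z • Z) = ω₂.power (x • X + y • Y + z • Z) ↔
        x = 0 ∨ ω₁.power X = ω₂.power X := by
    rw [power_barycentric _ h, power_barycentric _ h, hY, hZ, sub_left_inj, add_left_inj,
      add_left_inj, mul_eq_mul_left_iff, or_comm]
  have hX : ω₁.power X ≠ ω₂.power X := by
    obtain ⟨x, y, z, h, rfl⟩ := exists_barycentric finrank_euclideanSpace_fin hi P
    exact fun hX => hP ((hpow h).mpr (.inr hX))
  refine ⟨finrank_direction_line (dist_pos.mp (side_pos hi).1), ω₁, ω₂, hs, ht, Set.ext fun Q => ?_⟩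
  obtain ⟨x, y, z, h, rfl⟩ := exists_barycentric finrank_euclideanSpace_fin hi Q
  exact (mem_line_iff_barycentric hi h).trans ((or_iff_left hX).symm.trans (hpow h).symm)

theorem det_ne_zero_of_abs_lt {x y z : ℝ} (hx : |x| < 1 / 2) (hy : |y| < 1 / 2)
    (hz : |z| < 1 / 2) : !![1, z, y; z, 1, x; y, x, 1].det ≠ 0 := by
  have row_fst : |z| + |y| < 1 := by linarith
  have row_snd : |z| + |x| < 1 := by linarith
  have row_trd : |y| + |x| < 1 := by linarith
  refine det_ne_zero_of_sum_row_lt_diag fun i => ?_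
  rw [Finset.sum_erase_eq_sub (Finset.mem_univ i), Fin.sum_univ_three]
  fin_cases i
  · simpa [add_assoc] using row_fst
  · simpa [add_right_comm] using row_snd
  · simpa using row_trd

theorem side_add_pos {E : Type*} [NormedAddCommGroup E] [NormedSpace ℝ E] {A B C : E} {y z : ℝ}
    (hi : AffineIndependent ℝ ![A, B, C]) (hy : |y| < 1 / 2) (hz : |z| < 1 / 2) (h : 0 < y + z) :
    0 < dist B C + dist C A * y + dist A B * z := by
  obtain ⟨ha, hb, hc⟩ := side_pos hi
  have hyz : |y - z| ≤ 1 := (abs_sub y z).trans (by linarith)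
  have hbc : |dist C A - dist A B| ≤ dist B C := by
    rw [dist_comm A B, dist_comm B C]
    exact abs_dist_sub_le C B A
  have hprod : |(dist C A - dist A B) * (y - z)| ≤ dist B C * 1 := by
    rw [abs_mul]
    exact mul_le_mul hbc hyz (abs_nonneg _) ha.le
  have hsum : 0 < (dist C A + dist A B) * (y + z) := by positivity
  linarith [neg_abs_le ((dist C A - dist A B) * (y - z))]

namespace HasThirdAngles

section InnerProductSpace

variable {E : Type*} [NormedAddCommGroup E] [InnerProductSpace ℝ E] {A B C : E} {α β γ : ℝ}

theorem abs_morleyCos_lt (h : HasThirdAngles A B C α β γ) : |morleyCos α| < 1 / 2 :=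
  abs_morleyCos_lt_half h.pos h.lt

theorem morleyCos_add_pos (h : HasThirdAngles A B C α β γ) : 0 < morleyCos β + morleyCos γ :=
  morleyCos_add_morleyCos_pos h.rotate.pos h.rotate.rotate.pos (by linarith [h.add_eq, h.pos])

theorem exists_hasTrilinears_morleyCos (h : HasThirdAngles A B C α β γ) :
    ∃ X, HasTrilinears A B C X 1 (morleyCos γ) (morleyCos β) := by
  refine HasTrilinears.exists_of_sum_ne_zero ?_
  rw [mul_one]
  exact (side_add_pos h.affineIndependent h.rotate.rotate.abs_morleyCos_lt
    h.rotate.abs_morleyCos_lt (by linarith [h.morleyCos_add_pos])).ne'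

theorem perspector_sum_pos_of_pos (h : HasThirdAngles A B C α β γ) (hβ : 0 < morleyCos β)
    (hγ : 0 < morleyCos γ) : 0 < dist B C * (morleyCos β * morleyCos γ) +
      dist C A * (morleyCos α * morleyCos γ) + dist A B * (morleyCos α * morleyCos β) := by
  obtain ⟨-, hb, hc⟩ := side_pos h.affineIndependent
  have hsinβ := Real.sin_pos_of_pos_of_lt_pi h.rotate.pos (by linarith [h.rotate.lt, Real.pi_pos])
  have hsinγ := Real.sin_pos_of_pos_of_lt_pi h.rotate.rotate.pos
    (by linarith [h.rotate.rotate.lt, Real.pi_pos])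
  have hsq {t : ℝ} (ht : |t| < 1 / 2) : 0 < 1 - 4 * t ^ 2 := by
    linarith [(sq_lt_sq₀ (abs_nonneg t) one_half_pos.le).mpr ht, sq_abs t]
  have hβ' := hsq h.rotate.abs_morleyCos_lt
  have hγ' := hsq h.rotate.rotate.abs_morleyCos_lt
  -- The side `BC` is eliminated by the projection formula `a = b cos C + c cos B`.
  calc 0 < dist C A * morleyCos γ * (morleyCos β * morleyCos γ * (1 - 4 * morleyCos γ ^ 2) +
          2 * (Real.sin β * Real.sin γ)) +
        dist A B * morleyCos β * (morleyCos β * morleyCos γ * (1 - 4 * morleyCos β ^ 2) +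
          2 * (Real.sin β * Real.sin γ)) := by positivity
    _ = _ := by
      rw [h.dist_eq_add, cos_three_mul_eq_morleyCos, cos_three_mul_eq_morleyCos,
        ← morleyCos_add_two_mul h.add_eq]
      ring

theorem perspector_sum_pos (h : HasThirdAngles A B C α β γ) :
    0 < dist B C * (morleyCos β * morleyCos γ) + dist C A * (morleyCos α * morleyCos γ) +
      dist A B * (morleyCos α * morleyCos β) := by
  rcases lt_or_ge 0 (morleyCos β) with hβ | hβ
  · rcases lt_or_ge 0 (morleyCos γ) with hγ | hγ
    · exact h.perspector_sum_pos_of_pos hβ hγ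
    · linarith [h.rotate.rotate.perspector_sum_pos_of_pos
        (by linarith [h.rotate.morleyCos_add_pos]) hβ]
  · linarith [h.rotate.perspector_sum_pos_of_pos (by linarith [h.morleyCos_add_pos])
      (by linarith [h.rotate.rotate.morleyCos_add_pos])]

end InnerProductSpace

section Plane

variable {A B C X Y Z : Plane} {α β γ : ℝ}

theorem power_eq_power_iff_morleyCos {ω ω' : Sphere Plane} {P : Plane} {x y z : ℝ}
    (h : HasThirdAngles A B C α β γ)
    (hω : HasTrilinearEquation A B C ω (hexU α + hexV α) ((hexU α + hexV α) ^ 2)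
      (hexV α * hexV β) (hexV α * hexV γ))
    (hω' : HasTrilinearEquation A B C ω' (hexU α + hexV α) 0 (hexV γ) (hexV β))
    (hP : HasTrilinears A B C P x y z) :
    ω.power P = ω'.power P ↔ (1 - morleyCos α ^ 2) * x +
      (morleyCos α * morleyCos β - morleyCos γ) * y +
      (morleyCos α * morleyCos γ - morleyCos β) * z = 0 := by
  have hT := hexTriple_of_add_eq h.add_eq
  rw [hω.power_eq_power_iff h.affineIndependent hω' hP, morleyCos_eq, morleyCos_eq, morleyCos_eq]
  constructor <;> intro h0
  · linear_combination 3 / 4 * h0 - x / 4 * hT.three_mul_add_sq - y / 4 * hT.three_mul_sub -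
      z / 4 * hT.swap.three_mul_sub
  · linear_combination 4 / 3 * h0 + x / 3 * hT.three_mul_add_sq + y / 3 * hT.three_mul_sub +
      z / 3 * hT.swap.three_mul_sub

theorem isRadicalLineOf_line {A_A B_A C_A A_B B_B C_B A_C B_C C_C : Plane}
    (h : HasThirdAngles A B C α β γ) (hA : IsExternalMorleyTriangle A B C A_A B_A C_A)
    (hB : IsExternalMorleyTriangle B C A B_B C_B A_B)
    (hC : IsExternalMorleyTriangle C A B C_C A_C B_C) (hXYZ : AffineIndependent ℝ ![X, Y, Z])
    (hY : HasTrilinears A B C Y (morleyCos γ) 1 (morleyCos α))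
    (hZ : HasTrilinears A B C Z (morleyCos β) (morleyCos α) 1) :
    IsRadicalLineOf line[ℝ, Y, Z] {A_A, A_B, A_C} {C_A, B_A, B_B, C_C} := by
  obtain ⟨ω, hs, hω⟩ := h.exists_circle_fst hA hB hC
  obtain ⟨ω', ht, hω'⟩ := h.exists_circle_snd hA hB hC
  have hpow {P : Plane} {x y z : ℝ} (hP : HasTrilinears A B C P x y z) :=
    h.power_eq_power_iff_morleyCos hω hω' hP
  have hvertex := HasTrilinears.vertex (A := A) (dist_pos.mp (side_pos h.affineIndependent).1)
  have hlt := (sq_lt_one_iff_abs_lt_one _).mpr (h.abs_morleyCos_lt.trans one_half_lt_one)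
  refine isRadicalLineOf_line_of_power_eq hs ht (P := A) hXYZ ((hpow hY).mpr (by ring))
    ((hpow hZ).mpr (by ring)) fun hpowA => ?_
  linarith [(hpow hvertex).mp hpowA]

theorem arePerspective (h : HasThirdAngles A B C α β γ)
    (hX : HasTrilinears A B C X 1 (morleyCos γ) (morleyCos β))
    (hY : HasTrilinears A B C Y (morleyCos γ) 1 (morleyCos α))
    (hZ : HasTrilinears A B C Z (morleyCos β) (morleyCos α) 1) : ArePerspective A B C X Y Z := by
  have ne_or_ne {s t : ℝ} (hst : 0 < s + t) : t ≠ 0 ∨ s ≠ 0 := by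
    by_contra! h0
    linarith
  obtain ⟨P, hP⟩ := HasTrilinears.exists_of_sum_ne_zero h.perspector_sum_pos.ne'
  refine ⟨hX.vertex_ne h.affineIndependent (ne_or_ne h.morleyCos_add_pos),
    hY.rotate.vertex_ne h.rotate.affineIndependent (ne_or_ne h.rotate.morleyCos_add_pos),
    hZ.rotate.rotate.vertex_ne h.rotate.rotate.affineIndependent
      (ne_or_ne h.rotate.rotate.morleyCos_add_pos),
    P, hX.mem_line_vertex hP,
    hY.rotate.mem_line_vertex (t := morleyCos β) (x' := morleyCos α * morleyCos γ) ?_,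
    hZ.rotate.rotate.mem_line_vertex (t := morleyCos γ) (x' := morleyCos α * morleyCos β) ?_⟩
  · rw [mul_comm (morleyCos β)]
    exact hP.rotate
  · rw [mul_comm (morleyCos γ), mul_comm (morleyCos γ)]
    exact hP.rotate.rotate

end Plane

end HasThirdAngles

theorem mainTheorem12
    (A B C : Plane) (hABC : AffineIndependent ℝ ![A, B, C])
    (A_A B_A C_A A_B B_B C_B A_C B_C C_C : Plane)
    (hA : IsExternalMorleyTriangle A B C A_A B_A C_A)
    (hB : IsExternalMorleyTriangle B C A B_B C_B A_B)
    (hC : IsExternalMorleyTriangle C A B C_C A_C B_C) :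
    ∃ l_A l_B l_C : AffineSubspace ℝ Plane,
      IsRadicalLineOf l_A {A_A, A_B, A_C} {C_A, B_A, B_B, C_C} ∧
      IsRadicalLineOf l_B {B_B, B_C, B_A} {A_B, C_B, C_C, A_A} ∧
      IsRadicalLineOf l_C {C_C, C_A, C_B} {B_C, A_C, A_A, B_B} ∧
      ∃ X Y Z : Plane, FormTriangle l_A l_B l_C X Y Z ∧ ArePerspective A B C X Y Z := by
  obtain ⟨α, β, γ, h⟩ := HasThirdAngles.exists_of_affineIndependent hABC
  obtain ⟨X, hX⟩ := h.exists_hasTrilinears_morleyCos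
  obtain ⟨Y, hY'⟩ := h.rotate.exists_hasTrilinears_morleyCos
  obtain ⟨Z, hZ'⟩ := h.rotate.rotate.exists_hasTrilinears_morleyCos
  have hY := hY'.rotate.rotate
  have hZ := hZ'.rotate
  have hXYZ : AffineIndependent ℝ ![X, Y, Z] := hX.affineIndependent hABC hY hZ
    (det_ne_zero_of_abs_lt h.abs_morleyCos_lt h.rotate.abs_morleyCos_lt
      h.rotate.rotate.abs_morleyCos_lt)
  have hYZX := hXYZ.comm_left.comm_right
  have hZXY := hYZX.comm_left.comm_right
  exact ⟨line[ℝ, Y, Z], line[ℝ, Z, X], line[ℝ, X, Y],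
    h.isRadicalLineOf_line hA hB hC hXYZ hY hZ,
    h.rotate.isRadicalLineOf_line hB hC hA hYZX hZ.rotate hX.rotate,
    h.rotate.rotate.isRadicalLineOf_line hC hA hB hZXY hX.rotate.rotate hY.rotate.rotate,
    X, Y, Z, ⟨hXYZ, rfl, rfl, rfl⟩, h.arePerspective hX hY hZ⟩
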